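/- For $\operatorname{Re} u>0$, let the Lerch transcendent $\Phi(z,s,u)$ be defined, for $z\in\mathbb{C}\setminus[1,\infty)$ and $s\in\mathbb{C}$, as the analytic continuation in $z$ from the disc $|z|<1$ to $\mathbb{C}\setminus[1,\infty)$ of the series $\sum_{n=0}^{\infty} z^n (u+n)^{-s}$ (principal powers), and for $z=1$, $\operatorname{Re} s>1$ as the sum of this series. Let $m\ge 1$ be an integer and let $u_1,\dots,u_m\in\mathbb{C}$ satisfy $\operatorname{Re} u_i>0$ for all $i$ and $u_i\ne u_j$ whenever $i\ne j$. Let $z,s\in\mathbb{C}$ be such that either $z\in\mathbb{C}\setminus[1,\infty)$ and $\operatorname{Re} s>-1$, or $z=1$ and $\operatorname{Re} s>0$. Then the following integral converges absolutely and $$\int_{[0,1]^m}\frac{x_1^{u_1-1}x_2^{u_2-1}\cdots x_m^{u_m-1}}{1-z\,x_1x_2\cdots x_m}\,\bigl(-\ln (x_1x_2\cdots x_m)\bigr)^{s}\,dx_1\,dx_2\cdots dx_m=\Gamma(s+1)\sum_{i=1}^m\frac{\Phi(z,s+1,u_i)}{\prod_{j\ne i}(u_j-u_i)}.$$ -/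

import Mathlib

open scoped BigOperators

/-- The cut plane `ℂ ∖ [1, ∞)`. -/
def cutPlane : Set ℂ := ((fun x : ℝ => (x : ℂ)) '' Set.Ici (1 : ℝ))ᶜ

/-- The Lerch series `∑ zⁿ / (u + n) ^ s`, the powers being principal ones. -/
noncomputable def lerchSeries (z s u : ℂ) : ℂ :=
  ∑' n : ℕ, z ^ n / (u + (n : ℂ)) ^ s

/-- `f` is an analytic continuation, in the variable `z`, of the Lerch series with parameters
`s` and `u` from the open unit disc to the cut plane `ℂ ∖ [1, ∞)`. -/
def IsLerchContinuation (s u : ℂ) (f : ℂ → ℂ) : Prop :=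
  DifferentiableOn ℂ f cutPlane ∧ ∀ z : ℂ, ‖z‖ < 1 → f z = lerchSeries z s u

open Classical in
/-- The Lerch transcendent `Φ(z, s, u)`: on the cut plane the value at `z` of the analytic
continuation of the Lerch series, and elsewhere (in particular at `z = 1`) the sum of the
series itself. -/
noncomputable def lerchPhi (z s u : ℂ) : ℂ :=
  if h : z ∈ cutPlane ∧ ∃ f : ℂ → ℂ, IsLerchContinuation s u f then
    Classical.choose h.2 z
  else lerchSeries z s u

theorem mem_cutPlane_iff (z : ℂ) : z ∈ cutPlane ↔ (z.im = 0 → z.re < 1) := by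
  unfold cutPlane
  constructor
  · intro h him
    by_contra hre
    exact h ⟨z.re, not_lt.mp hre, Complex.ext (by simp) (by simp [him])⟩
  · rintro h ⟨x, hx, rfl⟩
    have h1 := h (by simp)
    simp only [Complex.ofReal_re] at h1
    exact absurd h1 (not_lt.mpr hx)

theorem isOpen_cutPlane : IsOpen cutPlane :=
  (Complex.isometry_ofReal.isClosedEmbedding.isClosedMap _ isClosed_Ici).isOpen_compl

theorem starConvex_cutPlane : StarConvex ℝ 0 cutPlane := by
  rw [starConvex_zero_iff]
  intro z hz a ha0 ha1
  rw [mem_cutPlane_iff] at hz ⊢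
  simp only [Complex.smul_im, Complex.smul_re, smul_eq_mul]
  intro him
  rcases mul_eq_zero.mp him with h | h
  · simp [h]
  · have := hz h
    rcases le_total z.re 0 with h0 | h0 <;> nlinarith

/-- The continuation is unique, so that `lerchPhi` does not depend on the choice made. -/
theorem lerchPhi_eq_of_isLerchContinuation {s u : ℂ} {f : ℂ → ℂ}
    (hf : IsLerchContinuation s u f) {z : ℂ} (hz : z ∈ cutPlane) :
    lerchPhi z s u = f z := by
  have h : z ∈ cutPlane ∧ ∃ f : ℂ → ℂ, IsLerchContinuation s u f := ⟨hz, f, hf⟩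
  rw [lerchPhi, dif_pos h]
  have hg := Classical.choose_spec h.2
  have h0 : (0 : ℂ) ∈ cutPlane := by simp [mem_cutPlane_iff]
  refine AnalyticOnNhd.eqOn_of_preconnected_of_eventuallyEq
    (hg.1.analyticOnNhd isOpen_cutPlane) (hf.1.analyticOnNhd isOpen_cutPlane)
    (starConvex_cutPlane.isPathConnected h0).isConnected.isPreconnected h0 ?_ hz
  filter_upwards [Metric.ball_mem_nhds (0 : ℂ) one_pos] with w hw
  have hw' : ‖w‖ < 1 := by simpa using hw
  rw [hg.2 w hw', hf.2 w hw']

/-- The integrand `x₁^{u₁-1} ⋯ x_m^{u_m-1} (-ln (x₁ ⋯ x_m))^s / (1 - z x₁ ⋯ x_m)`. -/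
noncomputable def lerchIntegrand {m : ℕ} (u : Fin m → ℂ) (z s : ℂ) (x : Fin m → ℝ) : ℂ :=
  (∏ i, (x i : ℂ) ^ (u i - 1)) / (1 - z * ∏ i, (x i : ℂ)) *
    ((-Real.log (∏ i, x i) : ℝ) : ℂ) ^ s

/-! Substituting `x i = exp (-t i)` turns the integrand into `∏ exp (-u i * t i)` times `h (∑ t i)`,
where `h t = t ^ s / (1 - z * exp (-t))`. For any `h` whose Laplace transform `L` converges
absolutely on the right half plane, the resulting integral is `∑ i, L (u i) / ∏ j ≠ i, (u j - u i)`
(`LaplaceIntegrable.setIntegral_cubeKernel`). This goes by induction on the number of variables.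
Integrating out the first one replaces `h` by its tail `T ↦ ∫ exp (-u 0 * t) * h (T + t)`, whose
transform at `v` is `(L v - L (u 0)) / (u 0 - v)`; a partial fraction identity collects the terms in
`L (u 0)`. Absolute convergence is the same induction run on norms, with `u i` replaced by its real
part; these real parts may coincide, but only the evaluation divides by differences. It remains that
`L u = Γ(s+1) Φ(z, s+1, u)`. For `‖z‖ < 1` and for `z = 1` this is termwise integration of the
geometric series; on the cut plane `L` is holomorphic in `z`, hence is the continuation. -/

open MeasureTheory Set

/-! ### Absolutely convergent Laplace transforms -/

/-- Measurable functions whose Laplace transform converges absolutely on `Re a > 0`. -/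
structure LaplaceIntegrable (h : ℝ → ℂ) : Prop where
  measurable : Measurable h
  integrableOn : ∀ a : ℝ, 0 < a → IntegrableOn (fun t : ℝ => Real.exp (-a * t) * ‖h t‖) (Ioi 0)

theorem norm_cexp_neg_mul_ofReal (u : ℂ) (t : ℝ) :
    ‖Complex.exp (-u * t)‖ = Real.exp (-u.re * t) := by
  simp [Complex.norm_exp]

namespace LaplaceIntegrable

variable {h : ℝ → ℂ}

theorem norm (hh : LaplaceIntegrable h) : LaplaceIntegrable (fun t => ((‖h t‖ : ℝ) : ℂ)) where
  measurable := Complex.measurable_ofReal.comp hh.measurable.norm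
  integrableOn a ha := by simpa using hh.integrableOn a ha

theorem measurable_cexp_mul (hh : LaplaceIntegrable h) (u : ℂ) :
    Measurable fun t : ℝ => Complex.exp (-u * t) * h t :=
  (by fun_prop : Measurable fun t : ℝ => Complex.exp (-u * t)).mul hh.measurable

theorem integrableOn_cexp_mul (hh : LaplaceIntegrable h) {u : ℂ} (hu : 0 < u.re) :
    IntegrableOn (fun t : ℝ => Complex.exp (-u * t) * h t) (Ioi 0) := by
  refine Integrable.mono' (hh.integrableOn _ hu)
    (hh.measurable_cexp_mul u).aestronglyMeasurable (Filter.Eventually.of_forall fun t => ?_)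
  rw [norm_mul, norm_cexp_neg_mul_ofReal]

/-- Half of the exponential absorbs the factor `t`. This bounds both the triangle integral and the
derivative of the transform. -/
theorem integrableOn_mul_exp_mul (hh : LaplaceIntegrable h) {a : ℝ} (ha : 0 < a) :
    IntegrableOn (fun t : ℝ => t * Real.exp (-a * t) * ‖h t‖) (Ioi 0) := by
  have hm := hh.measurable
  refine Integrable.mono' ((hh.integrableOn (a / 2) (by linarith)).const_mul (2 / a))
    (by fun_prop) ?_
  filter_upwards [ae_restrict_mem measurableSet_Ioi] with t (ht : 0 < t)
  rw [Real.norm_eq_abs, abs_of_nonneg (by positivity), ← mul_assoc]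
  refine mul_le_mul_of_nonneg_right ?_ (norm_nonneg _)
  have e : Real.exp (-a * t) = Real.exp (-(a / 2) * t) * Real.exp (-(a / 2 * t)) := by
    rw [← Real.exp_add]; ring_nf
  have h1 : a / 2 * t * Real.exp (-(a / 2 * t)) ≤ 1 := by
    rw [Real.exp_neg, ← div_eq_mul_inv, div_le_one (Real.exp_pos _)]
    linarith [Real.add_one_le_exp (a / 2 * t)]
  calc t * Real.exp (-a * t)
      = 2 / a * Real.exp (-(a / 2) * t) * (a / 2 * t * Real.exp (-(a / 2 * t))) := by
        rw [e]; field_simp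
    _ ≤ 2 / a * Real.exp (-(a / 2) * t) * 1 := by gcongr
    _ = _ := mul_one _

theorem integrableOn_cexp_mul_shift (hh : LaplaceIntegrable h) {u : ℂ} (hu : 0 < u.re) {T : ℝ}
    (hT : 0 ≤ T) : IntegrableOn (fun t : ℝ => Complex.exp (-u * t) * h (T + t)) (Ioi 0) := by
  have h1 := ((hh.integrableOn_cexp_mul hu).mono_set (Ioi_subset_Ioi hT)).const_mul
    (Complex.exp (u * T))
  have h2 := ((measurePreserving_add_left volume T).integrableOn_comp_preimage
    (measurableEmbedding_addLeft T)).2 h1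
  have h3 : (fun t : ℝ => T + t) ⁻¹' Ioi T = Ioi 0 := by ext; simp
  rw [h3] at h2
  refine h2.congr_fun (fun t _ => ?_) measurableSet_Ioi
  simp only [Function.comp, ← mul_assoc, ← Complex.exp_add]
  push_cast
  ring_nf

end LaplaceIntegrable

/-! ### The Laplace transform of a tail, by Fubini on a triangle -/

/-- The integrand of the double integral over the triangle `0 < T < r`. -/
noncomputable def triangleKernel (u v : ℂ) (h : ℝ → ℂ) (p : ℝ × ℝ) : ℂ :=
  (Ioi (0 : ℝ) ×ˢ Ioi (0 : ℝ)).indicator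
    (fun p : ℝ × ℝ => Complex.exp (-v * p.1) * (Complex.exp (-u * (p.2 : ℝ)) * h (p.1 + p.2)))
    (p.1, p.2 - p.1)

/-- In the coordinates `T` and `r = T + t` the factor `h r` is free of `T`, so the inner integral is
elementary. -/
theorem triangleKernel_eq_indicator (u v : ℂ) (h : ℝ → ℂ) (r T : ℝ) :
    triangleKernel u v h (T, r) = (Ioo 0 r).indicator
      (fun T : ℝ => Complex.exp ((u - v) * T) * (Complex.exp (-u * r) * h r)) T := by
  by_cases hT : T ∈ Ioo 0 r
  · rw [indicator_of_mem hT, triangleKernel, indicator_of_mem (by simpa using hT)]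
    simp only [← mul_assoc, ← Complex.exp_add]
    push_cast
    ring_nf
  · rw [indicator_of_notMem hT, triangleKernel, indicator_of_notMem (by simpa using hT)]

theorem measurable_triangleKernel (u v : ℂ) {h : ℝ → ℂ} (hh : Measurable h) :
    Measurable (triangleKernel u v h) := by
  have h1 : Measurable ((Ioi (0 : ℝ) ×ˢ Ioi (0 : ℝ)).indicator
    (fun p : ℝ × ℝ => Complex.exp (-v * p.1) *
      (Complex.exp (-u * (p.2 : ℝ)) * h (p.1 + p.2)))) := by
    refine Measurable.indicator ?_ (measurableSet_Ioi.prod measurableSet_Ioi)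
    fun_prop
  exact h1.comp (by fun_prop : Measurable fun p : ℝ × ℝ => (p.1, p.2 - p.1))

theorem integrable_triangleKernel {u v : ℂ} (hu : 0 < u.re) (hv : 0 < v.re) {h : ℝ → ℂ}
    (hh : LaplaceIntegrable h) : Integrable (triangleKernel u v h) (volume.prod volume) := by
  rw [integrable_prod_iff' (measurable_triangleKernel u v hh.measurable).aestronglyMeasurable]
  simp only [triangleKernel_eq_indicator]
  have hint : ∀ r : ℝ, IntegrableOn
      (fun T : ℝ => Complex.exp ((u - v) * T) * (Complex.exp (-u * r) * h r)) (Ioo 0 r) := by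
    intro r
    exact (Continuous.integrableOn_Icc (by fun_prop)).mono_set Ioo_subset_Icc_self
  refine ⟨Filter.Eventually.of_forall fun r => (hint r).integrable_indicator measurableSet_Ioo, ?_⟩
  set a := min u.re v.re with ha
  have ha0 : 0 < a := lt_min hu hv
  refine Integrable.mono' ((hh.integrableOn_mul_exp_mul ha0).integrable_indicator
    measurableSet_Ioi) ?_ (Filter.Eventually.of_forall fun r => ?_)
  · have := (measurable_triangleKernel u v hh.measurable).norm.stronglyMeasurable.integral_prod_left'
      (μ := (volume : Measure ℝ))
    simpa only [triangleKernel_eq_indicator] using this.aestronglyMeasurable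
  · simp only [norm_indicator_eq_indicator_norm]
    rw [integral_indicator measurableSet_Ioo]
    rw [Real.norm_of_nonneg (integral_nonneg fun _ => norm_nonneg _)]
    by_cases hr : 0 < r
    · rw [indicator_of_mem (by exact hr)]
      -- The exponent is `-u * (r - T) - v * T`, with both `r - T` and `T` positive, so its real
      -- part is at most `-a * r`.
      have hb : ∀ T ∈ Ioo 0 r, ‖Complex.exp ((u - v) * T) * (Complex.exp (-u * r) * h r)‖ ≤
          Real.exp (-a * r) * ‖h r‖ := by
        intro T hT
        rw [← mul_assoc, norm_mul, ← Complex.exp_add, Complex.norm_exp]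
        refine mul_le_mul_of_nonneg_right (Real.exp_le_exp.2 ?_) (norm_nonneg _)
        simp only [Complex.add_re, Complex.mul_re, Complex.sub_re, Complex.sub_im,
          Complex.neg_re, Complex.neg_im, Complex.ofReal_re, Complex.ofReal_im]
        have h1 : a ≤ u.re := min_le_left _ _
        have h2 : a ≤ v.re := min_le_right _ _
        nlinarith [hT.1, hT.2, mul_nonneg (sub_nonneg.2 h1) (sub_nonneg.2 hT.2.le),
          mul_nonneg (sub_nonneg.2 h2) hT.1.le]
      calc _ ≤ ∫ T in Ioo 0 r, Real.exp (-a * r) * ‖h r‖ :=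
            setIntegral_mono_on (hint r).norm (integrableOn_const (by simp)) measurableSet_Ioo hb
        _ = _ := by simp [hr.le, mul_assoc]
    · rw [Ioo_eq_empty hr, indicator_of_notMem (by exact hr)]
      simp

theorem integral_triangleKernel_left {u v : ℂ} (huv : u ≠ v) (h : ℝ → ℂ) (r : ℝ) :
    ∫ T, triangleKernel u v h (T, r) = (Ioi 0).indicator
      (fun r : ℝ => (Complex.exp (-v * r) - Complex.exp (-u * r)) / (u - v) * h r) r := by
  simp only [triangleKernel_eq_indicator]
  rw [integral_indicator measurableSet_Ioo]
  by_cases hr : 0 < r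
  · rw [indicator_of_mem (by exact hr), integral_mul_const, ← integral_Ioc_eq_integral_Ioo,
      ← intervalIntegral.integral_of_le hr.le, integral_exp_mul_complex (sub_ne_zero.2 huv)]
    have : Complex.exp (-v * r) = Complex.exp ((u - v) * r) * Complex.exp (-u * r) := by
      rw [← Complex.exp_add]; ring_nf
    rw [this]
    simp
    ring
  · rw [Ioo_eq_empty hr, indicator_of_notMem (by exact hr)]
    simp

/-- The measure-preserving shear `(T, t) ↦ (T, T + t)` carries the quadrant to the triangle. -/
theorem triangleKernel_comp_shear (u v : ℂ) (h : ℝ → ℂ) :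
    (triangleKernel u v h ∘ fun p : ℝ × ℝ => (p.1, p.1 + p.2)) =
      (Ioi (0 : ℝ) ×ˢ Ioi (0 : ℝ)).indicator (fun p : ℝ × ℝ =>
        Complex.exp (-v * p.1) * (Complex.exp (-u * (p.2 : ℝ)) * h (p.1 + p.2))) := by
  ext p
  simp [triangleKernel]

/-- The weighted tail `T ↦ ∫ e^{-ut} h(T + t) dt` of `h`. -/
noncomputable def laplaceTail (u : ℂ) (h : ℝ → ℂ) (T : ℝ) : ℂ :=
  ∫ t in Ioi (0 : ℝ), Complex.exp (-u * t) * h (T + t)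

namespace LaplaceIntegrable

variable {h : ℝ → ℂ}

theorem integrable_quadrant (hh : LaplaceIntegrable h) {u v : ℂ} (hu : 0 < u.re)
    (hv : 0 < v.re) : Integrable (fun p : ℝ × ℝ =>
        Complex.exp (-v * p.1) * (Complex.exp (-u * (p.2 : ℝ)) * h (p.1 + p.2)))
      ((volume.restrict (Ioi 0)).prod (volume.restrict (Ioi 0))) := by
  have h1 := (measurePreserving_prod_add (volume : Measure ℝ) (volume : Measure ℝ)).integrable_comp
    (integrable_triangleKernel hu hv hh).aestronglyMeasurable |>.2
    (integrable_triangleKernel hu hv hh)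
  rw [triangleKernel_comp_shear] at h1
  rw [Measure.prod_restrict]
  exact (integrable_indicator_iff (measurableSet_Ioi.prod measurableSet_Ioi)).1 h1

theorem measurable_laplaceTail (hh : LaplaceIntegrable h) (u : ℂ) :
    Measurable (laplaceTail u h) := by
  have hm := hh.measurable
  have : StronglyMeasurable (fun p : ℝ × ℝ => Complex.exp (-u * (p.2 : ℝ)) * h (p.1 + p.2)) :=
    Measurable.stronglyMeasurable (by fun_prop)
  exact (this.integral_prod_right (ν := volume.restrict (Ioi 0))).measurable

/-- Stability of the class under tails is what lets the induction on the number of variables run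
over arbitrary `h`. -/
theorem tail (hh : LaplaceIntegrable h) {u : ℂ} (hu : 0 < u.re) :
    LaplaceIntegrable (laplaceTail u h) where
  measurable := hh.measurable_laplaceTail u
  integrableOn a ha := by
    have h1 := (hh.integrable_quadrant hu (v := a) (by simpa using ha)).integral_prod_left.norm
    simp only [integral_const_mul, norm_mul, norm_cexp_neg_mul_ofReal, Complex.ofReal_re] at h1
    exact h1

theorem integral_cexp_mul_laplaceTail (hh : LaplaceIntegrable h) {u v : ℂ} (hu : 0 < u.re)
    (hv : 0 < v.re) (huv : u ≠ v) :
    ∫ T in Ioi (0 : ℝ), Complex.exp (-v * T) * laplaceTail u h T =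
      ∫ r in Ioi (0 : ℝ), (Complex.exp (-v * r) - Complex.exp (-u * r)) / (u - v) * h r := by
  have hk := integrable_triangleKernel hu hv hh
  have hmp := measurePreserving_prod_add (volume : Measure ℝ) (volume : Measure ℝ)
  have h1 := integral_prod _ (hh.integrable_quadrant hu hv)
  simp only [integral_const_mul] at h1
  simp only [laplaceTail]
  rw [← h1, Measure.prod_restrict, ← integral_indicator (measurableSet_Ioi.prod measurableSet_Ioi),
    ← triangleKernel_comp_shear]
  have h2 := integral_map hmp.aemeasurable (f := triangleKernel u v h)
    (by rw [hmp.map_eq]; exact hk.aestronglyMeasurable)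
  rw [hmp.map_eq] at h2
  simp only [Function.comp_def]
  rw [← h2, integral_prod_symm _ hk]
  simp only [integral_triangleKernel_left huv]
  rw [integral_indicator measurableSet_Ioi]

end LaplaceIntegrable

/-! ### The substitution `x = exp (-t)` -/

theorem image_exp_neg_Ioi : (fun t : ℝ => Real.exp (-t)) '' Ioi 0 = Ioo 0 1 := by
  ext x
  constructor
  · rintro ⟨t, ht, rfl⟩
    exact ⟨Real.exp_pos _, Real.exp_lt_one_iff.2 (neg_lt_zero.2 ht)⟩
  · rintro ⟨h0, h1⟩
    exact ⟨-Real.log x, neg_pos.2 (Real.log_neg h0 h1), by simp [Real.exp_log h0]⟩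

theorem hasDerivWithinAt_exp_neg (t : ℝ) (s : Set ℝ) :
    HasDerivWithinAt (fun t : ℝ => Real.exp (-t)) (-Real.exp (-t)) s t := by
  simpa using ((hasDerivAt_neg t).exp).hasDerivWithinAt

theorem injective_exp_neg : Function.Injective fun t : ℝ => Real.exp (-t) := fun a b hab => by
  simpa using hab

theorem abs_deriv_smul_exp_neg_substitution (u : ℂ) (h : ℝ → ℂ) (T t : ℝ) :
    |-Real.exp (-t)| • (((Real.exp (-t) : ℝ) : ℂ) ^ (u - 1) * h (T - Real.log (Real.exp (-t)))) =
      Complex.exp (-u * t) * h (T + t) := by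
  rw [abs_neg, abs_of_pos (Real.exp_pos _), Real.log_exp, sub_neg_eq_add, Complex.real_smul,
    ← mul_assoc, Complex.cpow_def_of_ne_zero (by exact_mod_cast (Real.exp_pos _).ne'),
    ← Complex.ofReal_log (Real.exp_pos _).le, Real.log_exp, Complex.ofReal_exp, ← Complex.exp_add]
  push_cast
  ring_nf

theorem setIntegral_Ioo_cpow_mul_comp_log (u : ℂ) (h : ℝ → ℂ) (T : ℝ) :
    ∫ x in Ioo (0 : ℝ) 1, (x : ℂ) ^ (u - 1) * h (T - Real.log x) = laplaceTail u h T := by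
  rw [← image_exp_neg_Ioi, integral_image_eq_integral_abs_deriv_smul measurableSet_Ioi
    (fun t _ => hasDerivWithinAt_exp_neg t _) injective_exp_neg.injOn]
  simp only [abs_deriv_smul_exp_neg_substitution, laplaceTail]

theorem LaplaceIntegrable.integrableOn_cpow_mul_comp_log {h : ℝ → ℂ} (hh : LaplaceIntegrable h)
    {u : ℂ} (hu : 0 < u.re) {T : ℝ} (hT : 0 ≤ T) :
    IntegrableOn (fun x : ℝ => (x : ℂ) ^ (u - 1) * h (T - Real.log x)) (Ioo 0 1) := by
  rw [← image_exp_neg_Ioi, integrableOn_image_iff_integrableOn_abs_deriv_smul measurableSet_Ioi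
    (fun t _ => hasDerivWithinAt_exp_neg t _) injective_exp_neg.injOn]
  simp only [abs_deriv_smul_exp_neg_substitution]
  exact hh.integrableOn_cexp_mul_shift hu hT

/-! ### Integration over the cube, one variable at a time -/

/-- The open unit cube. -/
def openCube (m : ℕ) : Set (Fin m → ℝ) := Set.univ.pi fun _ => Ioo 0 1

theorem measurableSet_openCube (m : ℕ) : MeasurableSet (openCube m) :=
  MeasurableSet.univ_pi fun _ => measurableSet_Ioo

theorem openCube_ae_eq_Icc (m : ℕ) :
    openCube m =ᵐ[volume] Icc (0 : Fin m → ℝ) 1 :=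
  Measure.univ_pi_Ioo_ae_eq_Icc

theorem mem_openCube_iff {m : ℕ} {x : Fin m → ℝ} : x ∈ openCube m ↔ ∀ i, x i ∈ Ioo (0 : ℝ) 1 := by
  simp [openCube]

theorem prod_pos_of_mem_openCube {m : ℕ} {x : Fin m → ℝ} (hx : x ∈ openCube m) : 0 < ∏ i, x i :=
  Finset.prod_pos fun i _ => (mem_openCube_iff.1 hx i).1

theorem neg_log_prod_nonneg_of_mem_openCube {m : ℕ} {x : Fin m → ℝ} (hx : x ∈ openCube m) :
    0 ≤ -Real.log (∏ i, x i) :=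
  neg_nonneg.2 (Real.log_nonpos (prod_pos_of_mem_openCube hx).le
    (Finset.prod_le_one (fun i _ => (mem_openCube_iff.1 hx i).1.le)
      fun i _ => (mem_openCube_iff.1 hx i).2.le))

/-- The function `∏ xᵢ^{uᵢ-1} h(-log ∏ xᵢ)` on the cube. -/
noncomputable def cubeKernel {m : ℕ} (u : Fin m → ℂ) (h : ℝ → ℂ) (x : Fin m → ℝ) : ℂ :=
  (∏ i, (x i : ℂ) ^ (u i - 1)) * h (-Real.log (∏ i, x i))

theorem measurable_cubeKernel {m : ℕ} (u : Fin m → ℂ) {h : ℝ → ℂ} (hh : Measurable h) :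
    Measurable (cubeKernel u h) := by
  refine Measurable.mul (Finset.measurable_fun_prod _ fun i _ => ?_) ?_
  · exact (Complex.measurable_ofReal.comp (measurable_pi_apply i)).pow_const _
  · exact hh.comp (Real.measurable_log.comp
      (Finset.measurable_fun_prod _ fun i _ => measurable_pi_apply i)).neg

theorem cubeKernel_cons {m : ℕ} (u : Fin (m + 1) → ℂ) (h : ℝ → ℂ) {x₀ : ℝ} {x : Fin m → ℝ}
    (hx₀ : x₀ ∈ Ioo (0 : ℝ) 1) (hx : x ∈ openCube m) :
    cubeKernel u h (Fin.cons x₀ x) = (∏ i, (x i : ℂ) ^ (u i.succ - 1)) *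
      ((x₀ : ℂ) ^ (u 0 - 1) * h (-Real.log (∏ i, x i) - Real.log x₀)) := by
  have := prod_pos_of_mem_openCube hx
  simp only [cubeKernel, Fin.prod_univ_succ, Fin.cons_zero, Fin.cons_succ]
  rw [Real.log_mul hx₀.1.ne' this.ne']
  ring_nf

theorem piFinSuccAbove_zero_symm (m : ℕ) :
    ((MeasurableEquiv.piFinSuccAbove (fun _ : Fin (m + 1) => ℝ) 0).symm :
      ℝ × (Fin m → ℝ) → Fin (m + 1) → ℝ) = fun p => Fin.cons p.1 p.2 := by
  ext p i
  simp [MeasurableEquiv.piFinSuccAbove, Fin.insertNthEquiv]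

theorem preimage_piFinSuccAbove_symm_openCube (m : ℕ) :
    (MeasurableEquiv.piFinSuccAbove (fun _ : Fin (m + 1) => ℝ) 0).symm ⁻¹' openCube (m + 1) =
      Ioo 0 1 ×ˢ openCube m := by
  ext p
  simp [mem_openCube_iff, Fin.forall_fin_succ]

theorem integrableOn_openCube_succ_iff {m : ℕ} (f : (Fin (m + 1) → ℝ) → ℂ) :
    IntegrableOn f (openCube (m + 1)) ↔
      Integrable (fun p : ℝ × (Fin m → ℝ) => f (Fin.cons p.1 p.2))
        ((volume.restrict (Ioo 0 1)).prod (volume.restrict (openCube m))) := by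
  have hmp := (volume_preserving_piFinSuccAbove (fun _ : Fin (m + 1) => ℝ) 0).symm
  have h1 := hmp.integrableOn_comp_preimage (MeasurableEquiv.measurableEmbedding _) (f := f)
    (s := openCube (m + 1))
  rw [← h1, Measure.prod_restrict, IntegrableOn]
  rw [preimage_piFinSuccAbove_symm_openCube, piFinSuccAbove_zero_symm]
  rfl

theorem setIntegral_openCube_succ {m : ℕ} (f : (Fin (m + 1) → ℝ) → ℂ) :
    ∫ x in openCube (m + 1), f x = ∫ p : ℝ × (Fin m → ℝ), f (Fin.cons p.1 p.2)
        ∂((volume.restrict (Ioo 0 1)).prod (volume.restrict (openCube m))) := by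
  have hmp := (volume_preserving_piFinSuccAbove (fun _ : Fin (m + 1) => ℝ) 0).symm
  have h1 := hmp.setIntegral_preimage_emb (MeasurableEquiv.measurableEmbedding _) f
    (openCube (m + 1))
  rw [← h1, Measure.prod_restrict]
  rw [preimage_piFinSuccAbove_symm_openCube, piFinSuccAbove_zero_symm]
  rfl

theorem setIntegral_cubeKernel_cons {m : ℕ} (u : Fin (m + 1) → ℂ) (h : ℝ → ℂ) {x : Fin m → ℝ}
    (hx : x ∈ openCube m) :
    ∫ x₀ in Ioo (0 : ℝ) 1, cubeKernel u h (Fin.cons x₀ x) =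
      cubeKernel (fun i => u i.succ) (laplaceTail (u 0) h) x := by
  rw [setIntegral_congr_fun measurableSet_Ioo fun x₀ hx₀ => cubeKernel_cons u h hx₀ hx,
    integral_const_mul, setIntegral_Ioo_cpow_mul_comp_log, cubeKernel]

/-- For positive `x`, `‖x ^ (u - 1)‖ = x ^ (u.re - 1)`, so norms of cube kernels are again cube
kernels. The inner integral required by Tonelli thus falls under the induction hypothesis. -/
theorem setIntegral_norm_cubeKernel_cons {m : ℕ} (u : Fin (m + 1) → ℂ) (h : ℝ → ℂ)
    {x : Fin m → ℝ} (hx : x ∈ openCube m) :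
    ∫ x₀ in Ioo (0 : ℝ) 1, ‖cubeKernel u h (Fin.cons x₀ x)‖ =
      ‖cubeKernel (fun i => ((u i.succ).re : ℂ))
        (laplaceTail (u 0).re fun t => ((‖h t‖ : ℝ) : ℂ)) x‖ := by
  rw [← setIntegral_cubeKernel_cons (fun i => ((u i).re : ℂ)) _ hx]
  have key : ∀ x₀ ∈ Ioo (0 : ℝ) 1, cubeKernel (fun i => ((u i).re : ℂ))
      (fun t => ((‖h t‖ : ℝ) : ℂ)) (Fin.cons x₀ x) =
        ((‖cubeKernel u h (Fin.cons x₀ x)‖ : ℝ) : ℂ) := by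
    intro x₀ hx₀
    have hmem : (Fin.cons x₀ x : Fin (m + 1) → ℝ) ∈ openCube (m + 1) := by
      rw [mem_openCube_iff, Fin.forall_fin_succ]
      exact ⟨by simpa using hx₀, by simpa using mem_openCube_iff.1 hx⟩
    generalize (Fin.cons x₀ x : Fin (m + 1) → ℝ) = y at hmem
    simp only [cubeKernel, norm_mul, norm_prod]
    push_cast
    congr 1
    refine Finset.prod_congr rfl fun i _ => ?_
    have hy := (mem_openCube_iff.1 hmem i).1
    rw [Complex.norm_cpow_eq_rpow_re_of_pos hy, Complex.ofReal_cpow hy.le]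
    simp
  rw [setIntegral_congr_fun measurableSet_Ioo key, integral_complex_ofReal, Complex.norm_real,
    Real.norm_of_nonneg (integral_nonneg fun _ => norm_nonneg _)]

theorem LaplaceIntegrable.integrableOn_cubeKernel {m : ℕ} {h : ℝ → ℂ} (hh : LaplaceIntegrable h)
    (u : Fin m → ℂ) (hu : ∀ i, 0 < (u i).re) : IntegrableOn (cubeKernel u h) (openCube m) := by
  induction m generalizing h with
  | zero =>
    have : IsFiniteMeasure (volume : Measure (Fin 0 → ℝ)) := by
      rw [volume_pi, Measure.pi_of_empty]; infer_instance
    rw [show cubeKernel u h = fun _ => cubeKernel u h default from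
      funext fun x => congrArg _ (Subsingleton.elim _ _)]
    exact integrable_const _
  | succ m ih =>
    rw [integrableOn_openCube_succ_iff, integrable_prod_iff']
    · constructor
      · filter_upwards [ae_restrict_mem (measurableSet_openCube m)] with x hx
        have := (hh.integrableOn_cpow_mul_comp_log (hu 0)
          (neg_log_prod_nonneg_of_mem_openCube hx)).const_mul (∏ i, (x i : ℂ) ^ (u i.succ - 1))
        exact IntegrableOn.congr_fun this (fun x₀ hx₀ => (cubeKernel_cons u h hx₀ hx).symm)
          measurableSet_Ioo
      · have h1 := (ih (hh.norm.tail (u := (u 0).re) (by simpa using hu 0))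
          (fun i => ((u i.succ).re : ℂ)) (fun i => by simpa using hu i.succ)).norm
        exact IntegrableOn.congr_fun h1
          (fun x hx => (setIntegral_norm_cubeKernel_cons u h hx).symm) (measurableSet_openCube m)
    · refine ((measurable_cubeKernel u hh.measurable).comp ?_).aestronglyMeasurable
      exact piFinSuccAbove_zero_symm m ▸ MeasurableEquiv.measurable _

theorem LaplaceIntegrable.setIntegral_cubeKernel_succ {m : ℕ} {h : ℝ → ℂ}
    (hh : LaplaceIntegrable h) (u : Fin (m + 1) → ℂ) (hu : ∀ i, 0 < (u i).re) :
    ∫ x in openCube (m + 1), cubeKernel u h x =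
      ∫ x in openCube m, cubeKernel (fun i => u i.succ) (laplaceTail (u 0) h) x := by
  rw [setIntegral_openCube_succ, integral_prod_symm _
    ((integrableOn_openCube_succ_iff _).1 (hh.integrableOn_cubeKernel u hu))]
  exact setIntegral_congr_fun (measurableSet_openCube m)
    fun x hx => setIntegral_cubeKernel_cons u h hx

/-- The zero-dimensional cube is a point of mass one, and the empty product has logarithm `0`. -/
theorem setIntegral_cubeKernel_zero (u : Fin 0 → ℂ) (h : ℝ → ℂ) :
    ∫ x in openCube 0, cubeKernel u h x = h 0 := by
  have : openCube 0 = univ := by ext; simp [openCube]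
  rw [this, Measure.restrict_univ, volume_pi, Measure.pi_of_empty, integral_dirac]
  simp [cubeKernel]

/-! ### Partial fractions and the evaluation for general `h` -/

open Lagrange in
/-- Partial fraction expansion of `∏ (u j - v)⁻¹`. -/
theorem sum_inv_prod_sub_div_sub {ι : Type*} [Fintype ι] [DecidableEq ι] [Nonempty ι] {u : ι → ℂ}
    (hu : Function.Injective u) {v : ℂ} (hv : ∀ i, v ≠ u i) :
    ∑ i, (∏ j ∈ Finset.univ.erase i, (u j - u i))⁻¹ / (u i - v) = (∏ j, (u j - v))⁻¹ := by
  -- Lagrange interpolation of the constant `1` at the nodes `u i`; the remaining work is matching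
  -- signs.
  have h1 := eval_interpolate_not_at_node (s := Finset.univ) (v := u) (x := v) (1 : ι → ℂ)
    fun i _ => hv i
  rw [interpolate_one hu.injOn Finset.univ_nonempty, Polynomial.eval_one, eval_nodal] at h1
  have h2 : ∏ j, (u j - v) = (-1) ^ Fintype.card ι * ∏ j, (v - u j) := by
    rw [← Finset.card_univ, ← Finset.prod_const, ← Finset.prod_mul_distrib]
    exact Finset.prod_congr rfl fun _ _ => by ring
  have h3 : ∀ i, (∏ j ∈ Finset.univ.erase i, (u j - u i))⁻¹ / (u i - v) =
      (-1) ^ Fintype.card ι * (nodalWeight Finset.univ u i * (v - u i)⁻¹ * (1 : ι → ℂ) i) := by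
    intro i
    have h4 : ∏ j ∈ Finset.univ.erase i, (u j - u i) =
        (-1) ^ (Fintype.card ι - 1) * ∏ j ∈ Finset.univ.erase i, (u i - u j) := by
      rw [← Finset.card_univ, ← Finset.card_erase_of_mem (Finset.mem_univ i), ← Finset.prod_const,
        ← Finset.prod_mul_distrib]
      exact Finset.prod_congr rfl fun _ _ => by ring
    obtain ⟨k, hk⟩ : ∃ k, Fintype.card ι = k + 1 :=
      Nat.exists_eq_succ_of_ne_zero Fintype.card_ne_zero
    rw [h4, nodalWeight, Finset.prod_inv_distrib, hk, mul_inv, ← neg_sub v (u i), Pi.one_apply,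
      add_tsub_cancel_right, pow_succ, ← inv_pow, inv_neg_one, div_eq_mul_inv, inv_neg]
    ring
  have h5 : ((-1 : ℂ) ^ Fintype.card ι)⁻¹ = (-1) ^ Fintype.card ι := by
    rw [← inv_pow, inv_neg_one]
  rw [Finset.sum_congr rfl fun i _ => h3 i, ← Finset.mul_sum, h2, mul_inv, h5,
    eq_inv_of_mul_eq_one_right h1.symm]

theorem prod_erase_zero {m : ℕ} (f : Fin (m + 1) → ℂ) :
    ∏ j ∈ Finset.univ.erase 0, f j = ∏ j : Fin m, f j.succ := by
  rw [show (Finset.univ : Finset (Fin (m + 1))).erase 0 = Finset.univ.image Fin.succ by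
    ext i; cases i using Fin.cases <;> simp]
  rw [Finset.prod_image (Fin.succ_injective m).injOn]

theorem prod_erase_succ {m : ℕ} (f : Fin (m + 1) → ℂ) (i : Fin m) :
    ∏ j ∈ Finset.univ.erase i.succ, f j = f 0 * ∏ j ∈ Finset.univ.erase i, f j.succ := by
  rw [show (Finset.univ : Finset (Fin (m + 1))).erase i.succ =
      insert 0 ((Finset.univ.erase i).image Fin.succ) by
    ext j; cases j using Fin.cases <;> simp [Fin.succ_ne_zero, eq_comm]]
  rw [Finset.prod_insert (by simp), Finset.prod_image (by simp)]

theorem LaplaceIntegrable.setIntegral_cubeKernel {m : ℕ} {h : ℝ → ℂ} (hh : LaplaceIntegrable h)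
    (u : Fin (m + 1) → ℂ) (hu : ∀ i, 0 < (u i).re) (hne : Function.Injective u) :
    ∫ x in openCube (m + 1), cubeKernel u h x =
      ∑ i, (∏ j ∈ Finset.univ.erase i, (u j - u i))⁻¹ *
        ∫ t in Ioi (0 : ℝ), Complex.exp (-u i * t) * h t := by
  induction m generalizing h with
  | zero =>
    rw [hh.setIntegral_cubeKernel_succ u hu, setIntegral_cubeKernel_zero]
    simp [laplaceTail]
  | succ m ih =>
    have h0 : ∀ i : Fin (m + 1), u 0 ≠ u i.succ := fun i hi => Fin.succ_ne_zero i (hne hi).symm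
    have hinj : Function.Injective fun i : Fin (m + 1) => u i.succ :=
      hne.comp (Fin.succ_injective _)
    rw [hh.setIntegral_cubeKernel_succ u hu, ih (hh.tail (hu 0)) _ (fun i => hu i.succ) hinj]
    have h1 : ∀ i : Fin (m + 1), ∫ t in Ioi (0 : ℝ),
        Complex.exp (-u i.succ * t) * laplaceTail (u 0) h t =
          ((∫ t in Ioi (0 : ℝ), Complex.exp (-u i.succ * t) * h t) -
            ∫ t in Ioi (0 : ℝ), Complex.exp (-u 0 * t) * h t) / (u 0 - u i.succ) := by
      intro i
      rw [hh.integral_cexp_mul_laplaceTail (hu 0) (hu i.succ) (h0 i), ← integral_sub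
        (hh.integrableOn_cexp_mul (hu i.succ)) (hh.integrableOn_cexp_mul (hu 0)),
        ← integral_div]
      congr 1 with t
      ring
    -- The coefficients of the transform at `u 0` add up to `(∏ j, (u j.succ - u 0))⁻¹`, by partial
    -- fractions at `v = u 0`.
    rw [Finset.sum_congr rfl fun i _ => by rw [h1 i], Fin.sum_univ_succ (n := m + 1), prod_erase_zero,
      ← sum_inv_prod_sub_div_sub hinj h0, Finset.sum_mul, ← Finset.sum_add_distrib]
    refine Finset.sum_congr rfl fun i _ => ?_
    rw [prod_erase_succ, mul_inv, ← neg_sub (u 0) (u i.succ)]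
    have := sub_ne_zero.2 (h0 i)
    field_simp
    ring

/-! ### Comparison, holomorphy, and the transform of a power -/

namespace LaplaceIntegrable

variable {h g : ℝ → ℂ}

theorem of_norm_le (hh : LaplaceIntegrable h) (hg : Measurable g) {C : ℝ}
    (hle : ∀ t, 0 < t → ‖g t‖ ≤ C * ‖h t‖) : LaplaceIntegrable g where
  measurable := hg
  integrableOn a ha := by
    refine Integrable.mono' ((hh.integrableOn a ha).const_mul C) (by fun_prop) ?_
    filter_upwards [ae_restrict_mem measurableSet_Ioi] with t ht
    rw [Real.norm_of_nonneg (by positivity), mul_left_comm]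
    exact mul_le_mul_of_nonneg_left (hle t ht) (Real.exp_pos _).le

theorem add_norm (hh : LaplaceIntegrable h) (hg : LaplaceIntegrable g) :
    LaplaceIntegrable fun t => ((‖h t‖ + ‖g t‖ : ℝ) : ℂ) where
  measurable := Complex.measurable_ofReal.comp (hh.measurable.norm.add hg.measurable.norm)
  integrableOn a ha := by
    refine ((hh.integrableOn a ha).add (hg.integrableOn a ha)).congr
      (Filter.Eventually.of_forall fun t => ?_)
    simp only [Pi.add_apply, Complex.norm_real]
    rw [Real.norm_of_nonneg (by positivity)]
    ring

theorem differentiableOn_integral_cexp_mul (hh : LaplaceIntegrable h) :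
    DifferentiableOn ℂ (fun u : ℂ => ∫ t in Ioi (0 : ℝ), Complex.exp (-u * t) * h t)
      {u : ℂ | 0 < u.re} := by
  intro u₀ (hu₀ : 0 < u₀.re)
  have hm := hh.measurable
  -- On this neighbourhood of `u₀` the derivative of the integrand has one integrable majorant.
  have hopen : IsOpen {u : ℂ | u₀.re / 2 < u.re} := isOpen_lt continuous_const Complex.continuous_re
  refine (hasDerivAt_integral_of_dominated_loc_of_deriv_le
    (F' := fun u t => Complex.exp (-u * t) * -t * h t)
    (bound := fun t => t * Real.exp (-(u₀.re / 2) * t) * ‖h t‖)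
    (hopen.mem_nhds (show u₀.re / 2 < u₀.re by linarith))
    (Filter.Eventually.of_forall fun u => (hh.measurable_cexp_mul u).aestronglyMeasurable)
    (hh.integrableOn_cexp_mul hu₀)
    (Measurable.aestronglyMeasurable (by fun_prop)) ?_
    (hh.integrableOn_mul_exp_mul (by linarith)) ?_).2.differentiableAt.differentiableWithinAt
  · filter_upwards [ae_restrict_mem measurableSet_Ioi] with t (ht : 0 < t) u (hu : u₀.re / 2 < u.re)
    rw [norm_mul, norm_mul, norm_neg, Complex.norm_real, Real.norm_of_nonneg ht.le,
      norm_cexp_neg_mul_ofReal, mul_comm t]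
    gcongr
  · refine Filter.Eventually.of_forall fun t u _ => HasDerivAt.mul_const ?_ _
    simpa using ((hasDerivAt_neg u).mul_const (t : ℂ)).cexp

end LaplaceIntegrable

theorem laplaceIntegrable_cpow {s : ℂ} (hs : -1 < s.re) :
    LaplaceIntegrable fun t : ℝ => (t : ℂ) ^ s where
  measurable := Complex.measurable_ofReal.pow_const s
  integrableOn a ha := by
    refine (integrableOn_rpow_mul_exp_neg_mul_rpow hs one_pos ha).congr_fun (fun t ht => ?_)
      measurableSet_Ioi
    simp only [Real.rpow_one]
    rw [Complex.norm_cpow_eq_rpow_re_of_pos ht, mul_comm]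

/-- The Laplace transform of a power, at a complex point of the right half plane. -/
theorem integral_cexp_mul_cpow {s u : ℂ} (hs : -1 < s.re) (hu : 0 < u.re) :
    ∫ t in Ioi (0 : ℝ), Complex.exp (-u * t) * (t : ℂ) ^ s =
      Complex.Gamma (s + 1) / u ^ (s + 1) := by
  have hopen : IsOpen {u : ℂ | 0 < u.re} := isOpen_lt continuous_const Complex.continuous_re
  have hconv : Convex ℝ {u : ℂ | 0 < u.re} := convex_halfSpace_re_gt 0
  have hd : DifferentiableOn ℂ (fun u : ℂ => Complex.Gamma (s + 1) / u ^ (s + 1))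
      {u : ℂ | 0 < u.re} := by
    intro w (hw : 0 < w.re)
    have hw0 : w ≠ 0 := by rintro rfl; simp at hw
    refine DifferentiableAt.differentiableWithinAt (DifferentiableAt.div (by fun_prop) ?_ ?_)
    · exact differentiableAt_id.cpow_const (Or.inl hw)
    · simp [Complex.cpow_eq_zero_iff, hw0]
  -- Both sides are holomorphic in `u` and agree at positive reals, which accumulate at `1`.
  refine AnalyticOnNhd.eqOn_of_preconnected_of_frequently_eq (z₀ := ((1 : ℝ) : ℂ))
    ((laplaceIntegrable_cpow hs).differentiableOn_integral_cexp_mul.analyticOnNhd hopen)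
    (hd.analyticOnNhd hopen) hconv.isPreconnected (by simp) ?_ hu
  have ht : Filter.Tendsto (fun x : ℝ => (x : ℂ)) (nhdsWithin 1 {1}ᶜ)
      (nhdsWithin ((1 : ℝ) : ℂ) {((1 : ℝ) : ℂ)}ᶜ) :=
    Complex.continuous_ofReal.continuousWithinAt.tendsto_nhdsWithin fun x hx => by
      simpa using hx
  refine ht.frequently (Filter.Eventually.frequently ?_)
  filter_upwards [nhdsWithin_le_nhds (Ioi_mem_nhds (zero_lt_one (α := ℝ)))] with x hx
  have hx : 0 < x := hx
  have := Complex.integral_cpow_mul_exp_neg_mul_Ioi (a := s + 1) (r := x)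
    (by simp; linarith) hx
  rw [add_sub_cancel_right, one_div, Complex.inv_cpow _ _
    (by rw [Complex.arg_ofReal_of_nonneg hx.le]; exact Real.pi_pos.ne)] at this
  rw [div_eq_inv_mul, ← this]
  refine setIntegral_congr_fun measurableSet_Ioi fun t _ => ?_
  rw [neg_mul, mul_comm]

/-! ### The Lerch transcendent as a Laplace transform -/

/-- The function whose Laplace transform is the Lerch transcendent. -/
noncomputable def lerchKernel (z s : ℂ) (t : ℝ) : ℂ :=
  (t : ℂ) ^ s / (1 - z * (Real.exp (-t) : ℝ))

theorem measurable_lerchKernel (z s : ℂ) : Measurable (lerchKernel z s) :=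
  (Complex.measurable_ofReal.pow_const s).div (by fun_prop)

theorem one_sub_mul_ne_zero_of_mem_cutPlane {z : ℂ} (hz : z ∈ cutPlane) {y : ℝ}
    (hy : y ∈ Icc (0 : ℝ) 1) : 1 - z * y ≠ 0 := by
  intro h
  have hy0 : y ≠ 0 := by rintro rfl; simp at h
  have hzy : z = ((y⁻¹ : ℝ) : ℂ) := by
    push_cast
    exact eq_inv_of_mul_eq_one_left (sub_eq_zero.1 h).symm
  exact hz ⟨y⁻¹, (one_le_inv₀ (lt_of_le_of_ne hy.1 hy0.symm)).2 hy.2, hzy.symm⟩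

/-- By compactness of a closed ball times `[0, 1]`, on which the denominator never vanishes.
Uniformity in `w` is needed to differentiate under the integral. -/
theorem exists_le_norm_one_sub_mul {z : ℂ} (hz : z ∈ cutPlane) :
    ∃ U ∈ nhds z, U ⊆ cutPlane ∧ ∃ δ > 0, ∀ w ∈ U, ∀ y ∈ Icc (0 : ℝ) 1, δ ≤ ‖1 - w * y‖ := by
  obtain ⟨ε, hε, hball⟩ := Metric.nhds_basis_closedBall.mem_iff.1 (isOpen_cutPlane.mem_nhds hz)
  refine ⟨_, Metric.closedBall_mem_nhds z hε, hball, ?_⟩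
  obtain ⟨p, hp, hmin⟩ := ((isCompact_closedBall z ε).prod (isCompact_Icc (a := (0 : ℝ)) (b := 1)))
    |>.exists_isMinOn ⟨(z, 0), by simp [hε.le]⟩
      (f := fun p : ℂ × ℝ => ‖1 - p.1 * p.2‖) (by fun_prop)
  exact ⟨_, norm_pos_iff.2 (one_sub_mul_ne_zero_of_mem_cutPlane (hball hp.1) hp.2),
    fun w hw y hy => hmin (show (w, y) ∈ _ from ⟨hw, hy⟩)⟩

theorem exp_neg_mem_Icc {t : ℝ} (ht : 0 < t) : Real.exp (-t) ∈ Icc (0 : ℝ) 1 :=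
  ⟨(Real.exp_pos _).le, Real.exp_le_one_iff.2 (neg_nonpos.2 ht.le)⟩

theorem laplaceIntegrable_lerchKernel_of_mem_cutPlane {z s : ℂ} (hz : z ∈ cutPlane)
    (hs : -1 < s.re) : LaplaceIntegrable (lerchKernel z s) := by
  obtain ⟨U, hU, -, δ, hδ, hle⟩ := exists_le_norm_one_sub_mul hz
  refine (laplaceIntegrable_cpow hs).of_norm_le (measurable_lerchKernel z s) (C := δ⁻¹)
    fun t ht => ?_
  rw [lerchKernel, norm_div, div_eq_inv_mul]
  gcongr
  exact hle z (mem_of_mem_nhds hU) _ (exp_neg_mem_Icc ht)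

/-- Since `1 - exp (-t) ≥ t / (1 + t)`, the kernel is at most `t ^ (s.re - 1) + t ^ s.re` in norm;
the first power forces `0 < s.re`. -/
theorem laplaceIntegrable_lerchKernel_one {s : ℂ} (hs : 0 < s.re) :
    LaplaceIntegrable (lerchKernel 1 s) := by
  refine ((laplaceIntegrable_cpow (s := s - 1) (by simp [hs])).add_norm
    (laplaceIntegrable_cpow (s := s) (by linarith))).of_norm_le (measurable_lerchKernel 1 s)
    (C := 1) fun t ht => ?_
  have h1 : t / (1 + t) ≤ 1 - Real.exp (-t) := by
    have h2 : Real.exp (-t) ≤ (1 + t)⁻¹ := by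
      rw [Real.exp_neg]
      exact inv_anti₀ (by linarith) (by linarith [Real.add_one_le_exp t])
    have h3 : t / (1 + t) = 1 - (1 + t)⁻¹ := by field_simp; ring
    linarith
  have h4 : ‖1 - 1 * ((Real.exp (-t) : ℝ) : ℂ)‖ = 1 - Real.exp (-t) := by
    rw [one_mul, ← Complex.ofReal_one, ← Complex.ofReal_sub, Complex.norm_real,
      Real.norm_of_nonneg (sub_nonneg.2 (exp_neg_mem_Icc ht).2)]
  rw [lerchKernel, norm_div, h4, one_mul, Complex.norm_real, Real.norm_of_nonneg (by positivity),
    Complex.norm_cpow_eq_rpow_re_of_pos ht, Complex.norm_cpow_eq_rpow_re_of_pos ht,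
    Complex.sub_re, Complex.one_re, Real.rpow_sub_one ht.ne']
  calc t ^ s.re / (1 - Real.exp (-t)) ≤ t ^ s.re / (t / (1 + t)) := by gcongr
    _ = _ := by field_simp

/-- The Laplace transform of `lerchKernel z s`. -/
noncomputable def lerchLaplace (z s u : ℂ) : ℂ :=
  ∫ t in Ioi (0 : ℝ), Complex.exp (-u * t) * lerchKernel z s t

theorem differentiableOn_lerchLaplace {s u : ℂ} (hs : -1 < s.re) (hu : 0 < u.re) :
    DifferentiableOn ℂ (fun z => lerchLaplace z s u) cutPlane := by
  intro z hz
  obtain ⟨U, hU, hUc, δ, hδ, hle⟩ := exists_le_norm_one_sub_mul hz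
  have hcp := laplaceIntegrable_cpow hs
  have hm := hcp.measurable
  refine (hasDerivAt_integral_of_dominated_loc_of_deriv_le
    (F' := fun w t => Complex.exp (-u * t) * ((t : ℂ) ^ s * (Real.exp (-t) : ℝ) /
      (1 - w * (Real.exp (-t) : ℝ)) ^ 2))
    (bound := fun t => Real.exp (-u.re * t) * ‖(t : ℂ) ^ s‖ * (δ ^ 2)⁻¹) hU
    (Filter.Eventually.of_forall fun w =>
      ((by fun_prop : Measurable fun t : ℝ => Complex.exp (-u * t)).mul
        (measurable_lerchKernel w s)).aestronglyMeasurable)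
    ((laplaceIntegrable_lerchKernel_of_mem_cutPlane hz hs).integrableOn_cexp_mul hu)
    (Measurable.aestronglyMeasurable (by fun_prop)) ?_
    ((hcp.integrableOn _ hu).mul_const _) ?_).2.differentiableAt.differentiableWithinAt
  · filter_upwards [ae_restrict_mem measurableSet_Ioi] with t ht w hw
    rw [norm_mul, norm_cexp_neg_mul_ofReal, norm_div, norm_mul, norm_pow, Complex.norm_real,
      Real.norm_of_nonneg (Real.exp_pos _).le, div_eq_mul_inv, mul_assoc (Real.exp _)]
    have h1 := hle w hw _ (exp_neg_mem_Icc ht)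
    have h2 := (exp_neg_mem_Icc ht).2
    gcongr
    exact mul_le_of_le_one_right (norm_nonneg _) h2
  · filter_upwards [ae_restrict_mem measurableSet_Ioi] with t ht w hw
    refine HasDerivAt.const_mul _ ?_
    have h1 := one_sub_mul_ne_zero_of_mem_cutPlane (hUc hw) (exp_neg_mem_Icc ht)
    have h2 := ((hasDerivAt_id w).mul_const ((Real.exp (-t) : ℝ) : ℂ)).const_sub 1
    have h3 := (hasDerivAt_const w ((t : ℂ) ^ s)).div h2 h1
    refine h3.congr_deriv ?_
    simp

/-- Up to the factor `Γ(s.re + 1)`, `hsum` is the sum of the `L¹` norms of the terms of the expanded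
geometric series. Stated this way it serves both `‖z‖ < 1` and `z = 1`. -/
theorem lerchLaplace_eq_lerchSeries {z s u : ℂ} (hz : ‖z‖ ≤ 1) (hs : -1 < s.re) (hu : 0 < u.re)
    (hsum : Summable fun n : ℕ => ‖z‖ ^ n * (1 / (u.re + n)) ^ (s.re + 1)) :
    lerchLaplace z s u = Complex.Gamma (s + 1) * lerchSeries z (s + 1) u := by
  have hcp := laplaceIntegrable_cpow hs
  have hun : ∀ n : ℕ, 0 < (u + n).re := fun n => by
    have : (0 : ℝ) ≤ n := n.cast_nonneg
    simp only [Complex.add_re, Complex.natCast_re]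
    linarith
  have hint : ∀ n : ℕ, IntegrableOn
      (fun t : ℝ => z ^ n * (Complex.exp (-(u + n) * t) * (t : ℂ) ^ s)) (Ioi 0) :=
    fun n => (hcp.integrableOn_cexp_mul (hun n)).const_mul _
  have hnorm : ∀ n : ℕ, ∫ t in Ioi (0 : ℝ),
      ‖z ^ n * (Complex.exp (-(u + n) * t) * (t : ℂ) ^ s)‖ =
        ‖z‖ ^ n * (1 / (u.re + n)) ^ (s.re + 1) * Real.Gamma (s.re + 1) := by
    intro n
    have hn : 0 < u.re + n := by simpa using hun n
    rw [mul_assoc, ← Real.integral_rpow_mul_exp_neg_mul_Ioi (by linarith) hn,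
      ← integral_const_mul]
    refine setIntegral_congr_fun measurableSet_Ioi fun t ht => ?_
    simp only [norm_mul, norm_pow, norm_cexp_neg_mul_ofReal, add_sub_cancel_right]
    rw [Complex.norm_cpow_eq_rpow_re_of_pos ht, Complex.add_re, Complex.natCast_re, neg_mul,
      mul_comm (Real.exp _)]
  have h1 := hasSum_integral_of_summable_integral_norm hint
    (by simp only [hnorm]; exact hsum.mul_right _)
  have h2 : lerchLaplace z s u = ∫ t in Ioi (0 : ℝ),
      ∑' n : ℕ, z ^ n * (Complex.exp (-(u + n) * t) * (t : ℂ) ^ s) := by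
    refine setIntegral_congr_fun measurableSet_Ioi fun t (ht : 0 < t) => ?_
    have hlt : ‖z * ((Real.exp (-t) : ℝ) : ℂ)‖ < 1 := by
      rw [norm_mul, Complex.norm_real, Real.norm_of_nonneg (Real.exp_pos _).le]
      exact (mul_le_of_le_one_left (Real.exp_pos _).le hz).trans_lt
        (Real.exp_lt_one_iff.2 (neg_lt_zero.2 ht))
    simp only [lerchKernel]
    rw [div_eq_mul_inv, ← tsum_geometric_of_norm_lt_one hlt, ← tsum_mul_left, ← tsum_mul_left]
    refine tsum_congr fun n => ?_
    have : Complex.exp (-(u + n) * t) = Complex.exp (-u * t) * ((Real.exp (-t) : ℝ) : ℂ) ^ n := by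
      rw [Complex.ofReal_exp, ← Complex.exp_nat_mul, ← Complex.exp_add]
      push_cast
      ring_nf
    rw [this, mul_pow]
    ring
  rw [h2, ← h1.tsum_eq, lerchSeries, ← tsum_mul_left]
  refine tsum_congr fun n => ?_
  rw [integral_const_mul, integral_cexp_mul_cpow hs (hun n)]
  ring

theorem summable_norm_pow_mul_rpow {z : ℂ} (hz : ‖z‖ < 1) {a σ : ℝ} (ha : 0 < a) (hσ : 0 ≤ σ) :
    Summable fun n : ℕ => ‖z‖ ^ n * (1 / (a + n)) ^ σ := by
  refine Summable.of_nonneg_of_le (fun n => by positivity) (fun n => ?_)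
    ((summable_geometric_of_lt_one (norm_nonneg z) hz).mul_right ((1 / a) ^ σ))
  gcongr
  exact le_add_of_nonneg_right n.cast_nonneg

theorem isLerchContinuation_lerchLaplace {s u : ℂ} (hs : -1 < s.re) (hu : 0 < u.re) :
    IsLerchContinuation (s + 1) u fun z => lerchLaplace z s u / Complex.Gamma (s + 1) := by
  refine ⟨(differentiableOn_lerchLaplace hs hu).div_const _, fun z hz => ?_⟩
  have hG : Complex.Gamma (s + 1) ≠ 0 := Complex.Gamma_ne_zero_of_re_pos (by simp; linarith)
  simp only
  rw [lerchLaplace_eq_lerchSeries hz.le hs hu (summable_norm_pow_mul_rpow hz hu (by linarith)),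
    mul_div_cancel_left₀ _ hG]

theorem lerchLaplace_eq_lerchPhi {z s u : ℂ}
    (hzs : (z ∈ cutPlane ∧ -1 < s.re) ∨ (z = 1 ∧ 0 < s.re)) (hu : 0 < u.re) :
    lerchLaplace z s u = Complex.Gamma (s + 1) * lerchPhi z (s + 1) u := by
  rcases hzs with ⟨hz, hs⟩ | ⟨rfl, hs⟩
  · have hG : Complex.Gamma (s + 1) ≠ 0 := Complex.Gamma_ne_zero_of_re_pos (by simp; linarith)
    rw [lerchPhi_eq_of_isLerchContinuation (isLerchContinuation_lerchLaplace hs hu) hz,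
      mul_div_cancel₀ _ hG]
  · have h1 : (1 : ℂ) ∉ cutPlane := by simp [mem_cutPlane_iff]
    rw [lerchPhi, dif_neg fun h => h1 h.1]
    refine lerchLaplace_eq_lerchSeries (by simp) (by linarith) hu ?_
    have h2 := (Real.summable_one_div_nat_add_rpow u.re (s.re + 1)).2 (by linarith)
    refine h2.congr fun n => ?_
    have hn : 0 < u.re + n := by positivity
    rw [norm_one, one_pow, one_mul, add_comm (n : ℝ), abs_of_pos hn,
      Real.div_rpow zero_le_one hn.le, Real.one_rpow]

theorem laplaceIntegrable_lerchKernel {z s : ℂ}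
    (hzs : (z ∈ cutPlane ∧ -1 < s.re) ∨ (z = 1 ∧ 0 < s.re)) :
    LaplaceIntegrable (lerchKernel z s) := by
  rcases hzs with ⟨hz, hs⟩ | ⟨rfl, hs⟩
  · exact laplaceIntegrable_lerchKernel_of_mem_cutPlane hz hs
  · exact laplaceIntegrable_lerchKernel_one hs

/-! ### Conclusion -/

theorem lerchIntegrand_eq_cubeKernel {m : ℕ} (u : Fin m → ℂ) (z s : ℂ) {x : Fin m → ℝ}
    (hx : x ∈ openCube m) : lerchIntegrand u z s x = cubeKernel u (lerchKernel z s) x := by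
  rw [lerchIntegrand, cubeKernel, lerchKernel, neg_neg, Real.exp_log (prod_pos_of_mem_openCube hx),
    Complex.ofReal_prod]
  ring

theorem theorem5 (m : ℕ) (hm : 1 ≤ m) (u : Fin m → ℂ) (hu : ∀ i, 0 < (u i).re)
    (hne : ∀ i j, i ≠ j → u i ≠ u j) (z s : ℂ)
    (hzs : (z ∈ cutPlane ∧ -1 < s.re) ∨ (z = 1 ∧ 0 < s.re)) :
    MeasureTheory.IntegrableOn (lerchIntegrand u z s) (Set.Icc (0 : Fin m → ℝ) 1)
        MeasureTheory.volume ∧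
      ∫ x in Set.Icc (0 : Fin m → ℝ) 1, lerchIntegrand u z s x =
        Complex.Gamma (s + 1) *
          ∑ i, lerchPhi z (s + 1) (u i) / ∏ j ∈ Finset.univ.erase i, (u j - u i) := by
  have hk := laplaceIntegrable_lerchKernel hzs
  have hcongr : EqOn (lerchIntegrand u z s) (cubeKernel u (lerchKernel z s)) (openCube m) :=
    fun x hx => lerchIntegrand_eq_cubeKernel u z s hx
  constructor
  · rw [← integrableOn_congr_set_ae (openCube_ae_eq_Icc m),
      integrableOn_congr_fun hcongr (measurableSet_openCube m)]
    exact hk.integrableOn_cubeKernel u hu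
  · obtain ⟨k, rfl⟩ := Nat.exists_eq_succ_of_ne_zero (Nat.one_le_iff_ne_zero.1 hm)
    rw [← setIntegral_congr_set (openCube_ae_eq_Icc (k + 1)),
      setIntegral_congr_fun (measurableSet_openCube (k + 1)) hcongr,
      hk.setIntegral_cubeKernel u hu fun i j hij => not_imp_comm.1 (hne i j) (not_not.2 hij),
      Finset.mul_sum]
    refine Finset.sum_congr rfl fun i _ => ?_
    rw [show ∫ t in Ioi (0 : ℝ), Complex.exp (-u i * t) * lerchKernel z s t =
      lerchLaplace z s (u i) from rfl, lerchLaplace_eq_lerchPhi hzs (hu i)]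
    ring
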